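/- Let $\mathbb K$ be a commutative unital ring and let $A$ be an associative, not necessarily unital, $\mathbb K$-algebra which is idempotented: for every $a\in A$ there is an idempotent $e\in A$ with $ae=ea=a$, and for any two idempotents $e_1,e_2\in A$ there is an idempotent $e\in A$ with $ee_k=e_ke=e_k$ for $k=1,2$. A left $A$-module $M$ is non-degenerate if for every $m\in M$ there is an idempotent $e\in A$ with $em=m$. Let $\mathsf M(A)$ be the abelian category of non-degenerate left $A$-modules and $\mathsf D(A)$ its (unbounded) derived category. An idempotent $e\in A$ is called left special if the full subcategory $\{M\in\mathsf M(A)\mid M=AeM\}$ of $\mathsf M(A)$ is closed under subquotients. For such $e$, the functor $\Gamma_e:\mathsf M(A)\to\mathsf M(A)$, $\Gamma_e(M)=AeM$, is exact, and its extension to $\mathsf D(A)$ is again denoted $\Gamma_e$. Let $\mathsf D(A)_e$ be the full subcategory of $\mathsf D(A)$ of all $M$ with $\Gamma_e(M)\cong M$; the functor $\Gamma_e$ takes values in $\mathsf D(A)_e$. A family $\{e_i\}_{i\in I}$ of left special idempotents of $A$ is called full if $e_iAe_j=e_jAe_i=0$ for all $i\neq j$, and $\sum_{i\in I}Ae_iA=A$.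 **Theorem.** Let $\{e_i\}_{i\in I}$ be a full family of left special idempotents of $A$. Then the functor $$\mathsf D(A)\longrightarrow\prod_{i\in I}\mathsf D(A)_{e_i},\qquad M\longmapsto(\Gamma_{e_i}(M))_{i\in I},$$ induced by the functors $\Gamma_{e_i}:\mathsf D(A)\to\mathsf D(A)_{e_i}$, is an equivalence of categories. -/

import Mathlib

open CategoryTheory CategoryTheory.Limits

universe u v w w'

/-- An associative (not necessarily unital) ring is *idempotented* if every element is fixed on
both sides by some idempotent, and any two idempotents are fixed on both sides by a common
idempotent. -/
class IsIdempotentedRing (A : Type v) [NonUnitalRing A] : Prop where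
  exists_idem : ∀ a : A, ∃ e : A, IsIdempotentElem e ∧ a * e = a ∧ e * a = a
  exists_idem_pair : ∀ e₁ e₂ : A, IsIdempotentElem e₁ → IsIdempotentElem e₂ →
    ∃ e : A, IsIdempotentElem e ∧ e * e₁ = e₁ ∧ e₁ * e = e₁ ∧ e * e₂ = e₂ ∧ e₂ * e = e₂

section Modules

variable (K : Type u) [CommRing K] (A : Type v) [NonUnitalRing A] [Module K A]
  [IsScalarTower K A A] [SMulCommClass K A A]

/-- The category of all left `A`-modules. A left module over the (non-unital) `K`-algebra `A`, i.e.
a `K`-module with a `K`-bilinear associative action of `A`, is the same thing as a unital left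
module over the unitization `K ⊕ A`; the element `a : A` acts through `Unitization.inr a`. -/
abbrev LeftMod := ModuleCat.{max u v} (Unitization K A)

/-- A left `A`-module `M` is non-degenerate if every `m ∈ M` satisfies `e m = m` for some
idempotent `e` of `A`. -/
def IsNonDegenerate : ObjectProperty (LeftMod K A) := fun M =>
  ∀ m : M, ∃ e : A, IsIdempotentElem e ∧ (Unitization.inr e : Unitization K A) • m = m

/-- The category `M(A)` of non-degenerate left `A`-modules. -/
abbrev NonDegMod := (IsNonDegenerate K A).FullSubcategory

instance : (IsNonDegenerate K A).IsClosedUnderSubobjects where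
  prop_of_mono {X Y} f _ hY := by
    intro m
    obtain ⟨e, he, h⟩ := hY (f.hom m)
    refine ⟨e, he, (ModuleCat.mono_iff_injective f).1 inferInstance ?_⟩
    simpa using h

instance : (IsNonDegenerate K A).IsClosedUnderQuotients where
  prop_of_epi {X Y} f _ hX := by
    intro m
    obtain ⟨n, rfl⟩ := (ModuleCat.epi_iff_surjective f).1 inferInstance m
    obtain ⟨e, he, h⟩ := hX n
    exact ⟨e, he, by rw [← map_smul, h]⟩

instance [IsIdempotentedRing A] : (IsNonDegenerate K A).ContainsZero where
  exists_zero := by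
    refine ⟨ModuleCat.of _ PUnit, ModuleCat.isZero_of_subsingleton _, fun m => ⟨0, ?_, rfl⟩⟩
    simp [IsIdempotentElem]

instance [IsIdempotentedRing A] : (IsNonDegenerate K A).IsClosedUnderFiniteProducts := by
  have : (IsNonDegenerate K A).IsClosedUnderBinaryProducts := by
    refine ⟨?_⟩
    rintro X ⟨p⟩ m
    obtain ⟨e₁, he₁, h₁⟩ := p.prop_diag_obj ⟨WalkingPair.left⟩ ((p.π.app _).hom m)
    obtain ⟨e₂, he₂, h₂⟩ := p.prop_diag_obj ⟨WalkingPair.right⟩ ((p.π.app _).hom m)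
    obtain ⟨e, he, h₁', -, h₂', -⟩ := IsIdempotentedRing.exists_idem_pair e₁ e₂ he₁ he₂
    refine ⟨e, he, Concrete.isLimit_ext p.diag p.isLimit _ _ ?_⟩
    rintro ⟨_ | _⟩
    · change (p.π.app _).hom _ = (p.π.app _).hom _
      rw [map_smul, ← h₁, smul_smul, ← Unitization.inr_mul, h₁']
    · change (p.π.app _).hom _ = (p.π.app _).hom _
      rw [map_smul, ← h₂, smul_smul, ← Unitization.inr_mul, h₂']
  exact .mk'

variable {K A}

/-- The submodule `AeM` of a left `A`-module `M`: it consists of the finite sums of elements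
`a e m` with `a : A` and `m : M`. -/
def generatedSubmodule (e : A) (M : LeftMod K A) : Submodule (Unitization K A) M :=
  Submodule.span (Unitization K A)
    {x | ∃ (a : A) (m : M), x = (Unitization.inr (a * e) : Unitization K A) • m}

variable (K) in
/-- The full subcategory `{M ∈ M(A) | M = AeM}` of `M(A)`. -/
def IsGeneratedBy (e : A) : ObjectProperty (NonDegMod K A) := fun M =>
  generatedSubmodule e M.obj = ⊤

variable (K) in
/-- An idempotent `e` is left special if `{M ∈ M(A) | M = AeM}` is closed under subquotients
(i.e. under subobjects and under quotients) in `M(A)`. -/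
structure IsLeftSpecial (e : A) : Prop where
  idem : IsIdempotentElem e
  closedUnderSubobjects : (IsGeneratedBy K e).IsClosedUnderSubobjects
  closedUnderQuotients : (IsGeneratedBy K e).IsClosedUnderQuotients

lemma generatedSubmodule_map (e : A) {M N : LeftMod K A} (f : M ⟶ N) {x : M}
    (hx : x ∈ generatedSubmodule e M) : f.hom x ∈ generatedSubmodule e N := by
  have : generatedSubmodule e M ≤ (generatedSubmodule e N).comap f.hom := by
    refine Submodule.span_le.2 ?_
    rintro _ ⟨a, m, rfl⟩
    exact Submodule.subset_span ⟨a, f.hom m, by rw [map_smul]⟩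
  exact this hx

/-- A submodule of a non-degenerate module, as an object of `M(A)`. -/
abbrev subNonDegMod (M : NonDegMod K A) (N : Submodule (Unitization K A) M.obj) :
    NonDegMod K A :=
  ⟨ModuleCat.of _ N,
    haveI := (ModuleCat.mono_iff_injective (ModuleCat.ofHom N.subtype)).2 N.injective_subtype
    (IsNonDegenerate K A).prop_of_mono (ModuleCat.ofHom N.subtype) M.property⟩

/-- The functor `Γ_e : M(A) ⥤ M(A)`, `M ↦ AeM`, given on morphisms by restriction. -/
def Gam (e : A) : NonDegMod K A ⥤ NonDegMod K A where
  obj M := subNonDegMod M (generatedSubmodule e M.obj)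
  map {M N} f := ObjectProperty.homMk (ModuleCat.ofHom
    (f.hom.hom.restrict fun _ hx => generatedSubmodule_map e f.hom hx))

instance (e : A) [IsIdempotentedRing A] : (Gam (K := K) e).Additive where
  map_add := rfl

lemma generatedSubmodule_generatedSubmodule {e : A} (he : IsIdempotentElem e) (M : LeftMod K A) :
    generatedSubmodule e (ModuleCat.of (Unitization K A) (generatedSubmodule e M)) = ⊤ := by
  refine eq_top_iff.2 fun x _ => ?_
  have key : generatedSubmodule e M ≤ (generatedSubmodule e
      (ModuleCat.of (Unitization K A) (generatedSubmodule e M))).map (generatedSubmodule e M).subtype := by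
    refine Submodule.span_le.2 ?_
    rintro _ ⟨a, m, rfl⟩
    refine ⟨(Unitization.inr (a * e) : Unitization K A) •
      ⟨_, Submodule.subset_span ⟨e, m, rfl⟩⟩, Submodule.subset_span ⟨a, _, rfl⟩, ?_⟩
    change (Unitization.inr (a * e) : Unitization K A) •
      ((Unitization.inr (e * e) : Unitization K A) • m) = _
    rw [smul_smul, ← Unitization.inr_mul, he.eq, mul_assoc, he.eq]
  obtain ⟨y, hy, hyx⟩ := key x.2
  rwa [← Subtype.ext hyx]

lemma IsLeftSpecial.generatedSubmodule_eq_top {e : A} (h : IsLeftSpecial K e) (M : NonDegMod K A)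
    (N : Submodule (Unitization K A) M.obj) (hN : N ≤ generatedSubmodule e M.obj) :
    generatedSubmodule e (ModuleCat.of (Unitization K A) N) = ⊤ := by
  let f : subNonDegMod M N ⟶ (Gam e).obj M :=
    ObjectProperty.homMk (ModuleCat.ofHom (Submodule.inclusion hN))
  have : Mono f.hom := (ModuleCat.mono_iff_injective _).2 (Submodule.inclusion_injective hN)
  have : Mono f := (IsNonDegenerate K A).ι.mono_of_mono_map this
  have := h.closedUnderSubobjects
  exact (IsGeneratedBy K e).prop_of_mono f
    (generatedSubmodule_generatedSubmodule h.idem M.obj)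

section Exactness

variable [IsIdempotentedRing A]

lemma nonDegMod_exact_iff (S : ShortComplex (NonDegMod K A)) :
    S.Exact ↔ ∀ x : S.X₂.obj, S.g.hom.hom x = 0 → ∃ y : S.X₁.obj, S.f.hom.hom y = x := by
  have : (IsNonDegenerate K A).ι.Additive := ⟨rfl⟩
  have : (IsNonDegenerate K A).ι.PreservesHomology :=
    ⟨fun {_ _} f => (IsNonDegenerate K A).preservesKernels_ι f,
     fun {_ _} f => (IsNonDegenerate K A).preservesCokernels_ι f⟩
  rw [← S.exact_map_iff_of_faithful (IsNonDegenerate K A).ι, ShortComplex.moduleCat_exact_iff]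
  rfl

/-- For a left special idempotent `e`, the functor `Γ_e` is exact. -/
lemma IsLeftSpecial.exact_Gam {e : A} (h : IsLeftSpecial K e) :
    PreservesFiniteLimits (Gam (K := K) e) ∧ PreservesFiniteColimits (Gam (K := K) e) := by
  refine ((Gam (K := K) e).exact_tfae.out 1 3).1 fun S hS => ?_
  rw [nonDegMod_exact_iff] at hS ⊢
  rintro ⟨x, hx⟩ hgx
  obtain ⟨y, hy⟩ := hS x (congrArg Subtype.val hgx)
  let N : Submodule (Unitization K A) S.X₂.obj :=
    generatedSubmodule e S.X₂.obj ⊓ LinearMap.range S.f.hom.hom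
  have hN := h.generatedSubmodule_eq_top S.X₂ N inf_le_left
  have key : generatedSubmodule e (ModuleCat.of (Unitization K A) N) ≤
      ((generatedSubmodule e S.X₁.obj).map S.f.hom.hom).comap N.subtype := by
    refine Submodule.span_le.2 ?_
    rintro _ ⟨a, ⟨_, -, m, rfl⟩, rfl⟩
    exact ⟨_, Submodule.subset_span ⟨a, m, rfl⟩, map_smul _ _ _⟩
  obtain ⟨z, hz, hzx⟩ := key (hN ▸ Submodule.mem_top : (⟨x, hx, y, hy⟩ : N) ∈ _)
  exact ⟨⟨z, hz⟩, Subtype.ext hzx⟩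

end Exactness

/-- The natural isomorphism `Γ_e ∘ Γ_e ≅ Γ_e`. -/
noncomputable def GamGamIso {e : A} (he : IsIdempotentElem e) :
    Gam (K := K) e ⋙ Gam e ≅ Gam e :=
  NatIso.ofComponents
    (fun M => ObjectProperty.isoMk _ (LinearEquiv.toModuleIso
      (LinearEquiv.ofTop _ (generatedSubmodule_generatedSubmodule he M.obj))))
    (fun _ => rfl)

end Modules

section Derived

variable {K : Type u} [CommRing K] {A : Type v} [NonUnitalRing A] [Module K A]
  [IsScalarTower K A A] [SMulCommClass K A A] [IsIdempotentedRing A]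
  [HasDerivedCategory.{w'} (NonDegMod K A)]

/-- For a left special idempotent `e`, the extension `Γ_e : D(A) ⥤ D(A)` of the exact functor
`Γ_e : M(A) ⥤ M(A)` to the derived category. -/
noncomputable def derivedGam {e : A} (h : IsLeftSpecial K e) :
    DerivedCategory (NonDegMod K A) ⥤ DerivedCategory (NonDegMod K A) :=
  haveI := h.exact_Gam.1
  haveI := h.exact_Gam.2
  (Gam (K := K) e).mapDerivedCategory

/-- The full subcategory `D(A)_e = {M ∈ D(A) | Γ_e(M) ≅ M}` of `D(A)`. -/
def derivedPart {e : A} (h : IsLeftSpecial K e) :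
    ObjectProperty (DerivedCategory (NonDegMod K A)) := fun M =>
  Nonempty ((derivedGam h).obj M ≅ M)

lemma derivedPart_derivedGam_obj {e : A} (h : IsLeftSpecial K e)
    (M : DerivedCategory (NonDegMod K A)) : derivedPart h ((derivedGam h).obj M) := by
  have := h.exact_Gam.1
  have := h.exact_Gam.2
  let G := Gam (K := K) e
  let C := G.mapHomologicalComplex (ComplexShape.up ℤ)
  let X := DerivedCategory.Q.objPreimage M
  let i : DerivedCategory.Q.obj X ≅ M := DerivedCategory.Q.objObjPreimageIso M
  let j : G.mapDerivedCategory.obj M ≅ DerivedCategory.Q.obj (C.obj X) :=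
    G.mapDerivedCategory.mapIso i.symm ≪≫ G.mapDerivedCategoryFactors.app X
  let k : C.obj (C.obj X) ≅ C.obj X :=
    (NatIso.mapHomologicalComplex (GamGamIso (K := K) h.idem) (ComplexShape.up ℤ)).app X
  exact ⟨G.mapDerivedCategory.mapIso j ≪≫ G.mapDerivedCategoryFactors.app (C.obj X) ≪≫
    DerivedCategory.Q.mapIso k ≪≫ j.symm⟩

/-- The functor `Γ_e : D(A) ⥤ D(A)_e`. -/
noncomputable def toDerivedPart {e : A} (h : IsLeftSpecial K e) :
    DerivedCategory (NonDegMod K A) ⥤ (derivedPart h).FullSubcategory :=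
  (derivedPart h).lift (derivedGam h) (derivedPart_derivedGam_obj h)

/-- The functor `D(A) ⥤ ∏ i, D(A)_{e i}` with components `Γ_{e i}`. -/
noncomputable def derivedPi {I : Type w} {e : I → A} (h : ∀ i, IsLeftSpecial K (e i)) :
    DerivedCategory (NonDegMod K A) ⥤ ∀ i, (derivedPart (h i)).FullSubcategory :=
  Functor.pi' fun i => toDerivedPart (h i)

end Derived

/-- A family of left special idempotents of `A` is full if it is pairwise strongly orthogonal
(`e_i A e_j = e_j A e_i = 0` for `i ≠ j`) and `∑ i, A e_i A = A`. -/
structure IsFullFamily (K : Type u) [CommRing K] {A : Type v} [NonUnitalRing A] [Module K A]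
    [IsScalarTower K A A] [SMulCommClass K A A] {I : Type w} (e : I → A) : Prop where
  isLeftSpecial : ∀ i, IsLeftSpecial K (e i)
  stronglyOrthogonal : ∀ i j, i ≠ j → ∀ a : A, e i * a * e j = 0 ∧ e j * a * e i = 0
  sum_eq_top : Submodule.span K {x : A | ∃ (i : I) (a b : A), x = a * e i * b} = ⊤

/-! For a non-degenerate module `M`, the sum of the `A e_i M` is `M` because `∑ A e_i A = A`. The
sum is direct: the intersection `N` of `A e_i M` with the sum of the other summands satisfies `N = A
e_i N` by left speciality, while strong orthogonality makes `A e_i` kill `N`. So the inclusions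
exhibit `M` as the coproduct of the `Γ_{e_i} M` (`IsFullFamily.nonempty_isColimit`).

Coproducts in `M(A)` are exact, so localization carries coproducts of complexes to coproducts in
`D(A)` (`DerivedCategory.isCoproductFamily_of_isColimit`). Hence every object of `D(A)` is the
coproduct of its `Γ_{e_i}`-parts through the derived counits (`isCoproductFamily_derivedCounit`).

The rest is formal (`isEquivalence_pi_of_isCoproductFamily`): morphisms are determined and built on
the summands, and a family `(Y_i)` comes from its coproduct. -/

/-! ### Coproducts over arbitrary index types and the formal splitting criterion -/

section FormalCoproducts

/-- `ι : ∀ i, Y i ⟶ X` exhibits `X` as a coproduct of the family `Y`. The index type may live in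
any universe. -/
def IsCoproductFamily {D : Type*} [Category* D] {I : Type*} {Y : I → D} {X : D}
    (ι : ∀ i, Y i ⟶ X) : Prop :=
  ∀ (T : D) (g : ∀ i, Y i ⟶ T), ∃! f : X ⟶ T, ∀ i, ι i ≫ f = g i

namespace IsCoproductFamily

variable {D : Type*} [Category* D] {I : Type*} {Y : I → D} {X : D} {ι : ∀ i, Y i ⟶ X}

lemma hom_ext (h : IsCoproductFamily ι) {T : D} {f g : X ⟶ T} (hfg : ∀ i, ι i ≫ f = ι i ≫ g) :
    f = g :=
  (h T fun i => ι i ≫ g).unique hfg fun _ => rfl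

lemma exists_desc (h : IsCoproductFamily ι) {T : D} (g : ∀ i, Y i ⟶ T) :
    ∃ f : X ⟶ T, ∀ i, ι i ≫ f = g i :=
  (h T g).exists

lemma mk' (h₁ : ∀ (T : D) (f g : X ⟶ T), (∀ i, ι i ≫ f = ι i ≫ g) → f = g)
    (h₂ : ∀ (T : D) (g : ∀ i, Y i ⟶ T), ∃ f : X ⟶ T, ∀ i, ι i ≫ f = g i) :
    IsCoproductFamily ι := fun T g =>
  existsUnique_of_exists_of_unique (h₂ T g) fun f f' hf hf' =>
    h₁ T f f' fun i => (hf i).trans (hf' i).symm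

lemma of_iso (h : IsCoproductFamily ι) {Y' : I → D} {X' : D} {ι' : ∀ i, Y' i ⟶ X'}
    (e : ∀ i, Y i ≅ Y' i) (e' : X ≅ X') (comm : ∀ i, ι i ≫ e'.hom = (e i).hom ≫ ι' i) :
    IsCoproductFamily ι' := by
  have comm' : ∀ i, ι' i ≫ e'.inv = (e i).inv ≫ ι i := fun i => by
    rw [Iso.eq_inv_comp, ← Category.assoc, ← comm, Category.assoc, e'.hom_inv_id, Category.comp_id]
  refine mk' (fun T f g hfg => ?_) fun T g => ?_
  · rw [← cancel_epi e'.hom]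
    refine h.hom_ext fun i => ?_
    rw [← Category.assoc, ← Category.assoc, comm, Category.assoc, Category.assoc, hfg]
  · obtain ⟨f, hf⟩ := h.exists_desc fun i => (e i).hom ≫ g i
    exact ⟨e'.inv ≫ f, fun i => by
      rw [← Category.assoc, comm', Category.assoc, hf, Iso.inv_hom_id_assoc]⟩

/-- Zero objects may be added to, or removed from, a coproduct. -/
lemma of_comp {J : Type*} {σ : J → I}
    (hY : ∀ i, i ∉ Set.range σ → IsZero (Y i)) (h : IsCoproductFamily fun j => ι (σ j)) :
    IsCoproductFamily ι := by
  refine mk' (fun T f g hfg => h.hom_ext fun j => hfg _) fun T g => ?_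
  obtain ⟨f, hf⟩ := h.exists_desc fun j => g (σ j)
  refine ⟨f, fun i => ?_⟩
  by_cases hi : i ∈ Set.range σ
  · obtain ⟨j, rfl⟩ := hi
    exact hf j
  · exact (hY i hi).eq_of_src _ _

lemma of_isColimit {I : Type*} {Y : I → D} {c : Cofan Y} (hc : IsColimit c) :
    IsCoproductFamily c.inj :=
  mk' (fun _ _ _ h => Cofan.IsColimit.hom_ext hc _ _ h) fun _ g =>
    ⟨Cofan.IsColimit.desc hc g, fun i => Cofan.IsColimit.fac hc g i⟩

end IsCoproductFamily

section Equivalence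

variable {D : Type*} [Category* D] [HasZeroMorphisms D] {I : Type*}
  (G : I → D ⥤ D) (ε : ∀ i, G i ⟶ 𝟭 D)

/-- A family of copointed idempotent endofunctors such that every object `M` is the coproduct
of the `G i M`, all suitable coproducts being available, splits the category as a product. -/
theorem isEquivalence_pi_of_isCoproductFamily
    (P : I → ObjectProperty D) (hP : ∀ i M, P i M ↔ Nonempty ((G i).obj M ≅ M))
    (hG : ∀ i M, P i ((G i).obj M))
    (hε : ∀ i M, (G i).map ((ε i).app M) = (ε i).app ((G i).obj M))
    (hiso : ∀ i M, IsIso ((ε i).app ((G i).obj M)))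
    (hdec : ∀ M, IsCoproductFamily fun i => (ε i).app M)
    (hex : ∀ Y : I → D, (∀ i, P i (Y i)) → ∃ (X : D) (ι : ∀ i, Y i ⟶ X), IsCoproductFamily ι) :
    (Functor.pi' fun i => (P i).lift (G i) (hG i)).IsEquivalence where
  faithful := ⟨fun {M N f g} hfg => (hdec M).hom_ext fun i => by
    have : (G i).map f = (G i).map g :=
      congrArg (fun φ => ((P i).ι.map φ)) (congrFun hfg i)
    have h₁ := (ε i).naturality f
    have h₂ := (ε i).naturality g
    dsimp at h₁ h₂
    rw [← h₁, ← h₂, this]⟩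
  full := ⟨fun {M N} g => by
    let g' : ∀ i, (G i).obj M ⟶ (G i).obj N := fun i => (P i).ι.map (g i)
    obtain ⟨f, hf⟩ := (hdec M).exists_desc fun i => g' i ≫ (ε i).app N
    refine ⟨f, funext fun i => (P i).ι.map_injective ?_⟩
    change (G i).map f = g' i
    have := hiso i M
    have := hiso i N
    have h₁ := (ε i).naturality (g' i)
    have h₂ := congrArg (G i).map (hf i)
    dsimp at h₁
    rw [(G i).map_comp, (G i).map_comp, hε, hε, h₁] at h₂
    exact (cancel_epi _).1 h₂⟩
  essSurj := ⟨fun Y => by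
    classical
    obtain ⟨X, ι, hι⟩ := hex (fun i => (Y i).obj) fun i => (Y i).property
    -- Membership only gives some isomorphism `G i Y ≅ Y`; naturality of the counit along it makes
    -- the counit itself invertible.
    have hY : ∀ i, IsIso ((ε i).app (Y i).obj) := fun i => by
      obtain ⟨φ⟩ := (hP i _).1 (Y i).property
      have := hiso i (Y i).obj
      have h := (ε i).naturality φ.hom
      dsimp at h
      exact IsIso.of_isIso_fac_left h
    have key : ∀ j, IsIso ((ε j).app X ≫ (hι.exists_desc (T := (Y j).obj) fun i =>
        if h : i = j then eqToHom (by rw [h]) else 0).choose) := by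
      intro j
      -- `X` has two coproduct decompositions, into the `Y i` and into the `G i X`. The projections
      -- `p` and `q` onto the `j`-th summands are matched by `a j`, which is the inverse sought.
      obtain ⟨q, hq⟩ := (hdec X).exists_desc (T := (G j).obj X) fun i =>
        if h : i = j then eqToHom (by rw [h]) else 0
      generalize_proofs _ hp
      have hp' := hp.choose_spec
      generalize hp.choose = p at hp'
      let a : ∀ i, (Y i).obj ⟶ (G i).obj X := fun i => inv ((ε i).app _) ≫ (G i).map (ι i)
      have ha : ∀ i, a i ≫ (ε i).app X = ι i := fun i => by
        have h := (ε i).naturality (ι i)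
        dsimp at h
        simp [a, h]
      have hpa : p ≫ a j = q := hι.hom_ext fun i => by
        rw [← Category.assoc, hp' i, ← ha i, Category.assoc, hq i]
        split_ifs with h
        · subst h; simp
        · simp
      refine ⟨a j, ?_, ?_⟩
      · rw [Category.assoc, hpa, hq j]; simp
      · rw [← Category.assoc, ha, hp' j]; simp
    exact ⟨X, ⟨Pi.isoMk fun j => (P j).isoMk (@asIso _ _ _ _ _ (key j))⟩⟩⟩

end Equivalence

end FormalCoproducts

/-! ### Exact coproducts and passage to the derived category -/

section DerivedCoproducts

variable {C : Type u} [Category.{v} C] [Abelian C]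

lemma isIso_of_comp_eq_comp {D : Type*} [Category* D] {W X Y Z : D} {a : W ⟶ X} {b : X ⟶ Z}
    {c : W ⟶ Y} {d : Y ⟶ Z} (ha : IsIso a) (hb : IsIso b) (hc : IsIso c) (h : a ≫ b = c ≫ d) :
    IsIso d :=
  have : IsIso (c ≫ d) := h ▸ inferInstance
  IsIso.of_isIso_comp_left c d

/-- Evaluation functors are exact and jointly detect isomorphisms, so homology of diagrams can be
tested pointwise. -/
lemma CategoryTheory.ShortComplex.quasiIso_of_evaluation {J : Type*} [Category* J]
    {S₁ S₂ : ShortComplex (J ⥤ C)} (φ : S₁ ⟶ S₂)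
    (h : ∀ j, ShortComplex.QuasiIso (((evaluation J C).obj j).mapShortComplex.map φ)) :
    ShortComplex.QuasiIso φ := by
  rw [ShortComplex.quasiIso_iff, NatTrans.isIso_iff_isIso_app]
  exact fun j => isIso_of_comp_eq_comp ((ShortComplex.quasiIso_iff _).1 (h j)) (Iso.isIso_hom _)
    (Iso.isIso_hom _) (ShortComplex.mapHomologyIso_hom_naturality φ ((evaluation J C).obj j))

namespace CochainComplex

variable {J : Type*} [Category* J]

/-- A diagram of complexes, seen as a complex of diagrams. -/
def complexOfFunctor (F : J ⥤ CochainComplex C ℤ) : CochainComplex (J ⥤ C) ℤ where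
  X n := F ⋙ HomologicalComplex.eval C _ n
  d m n := { app j := (F.obj j).d m n, naturality _ _ f := (F.map f).comm m n }
  shape m n h := by ext j; exact (F.obj j).shape m n h
  d_comp_d' _ _ _ _ _ := by ext j; exact (F.obj j).d_comp_d _ _ _

/-- A morphism of diagrams of complexes, seen as a morphism of complexes of diagrams. -/
def complexOfFunctorMap {F G : J ⥤ CochainComplex C ℤ} (α : F ⟶ G) :
    complexOfFunctor F ⟶ complexOfFunctor G where
  f n := Functor.whiskerRight α (HomologicalComplex.eval C _ n)
  comm' m n _ := by ext j; exact (α.app j).comm m n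

lemma quasiIso_complexOfFunctorMap {F G : J ⥤ CochainComplex C ℤ} (α : F ⟶ G)
    (hα : ∀ j, QuasiIso (α.app j)) : QuasiIso (complexOfFunctorMap α) where
  quasiIsoAt n := ⟨ShortComplex.quasiIso_of_evaluation _ fun j => ((hα j).quasiIsoAt n).quasiIso⟩

variable [HasColimitsOfShape J C] [HasExactColimitsOfShape J C]

/-- Quasi-isomorphisms are stable under exact colimits. -/
lemma quasiIso_of_isColimit {F G : J ⥤ CochainComplex C ℤ} (α : F ⟶ G)
    (hα : ∀ j, QuasiIso (α.app j)) {c : Cocone F} {d : Cocone G} (hc : IsColimit c)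
    (hd : IsColimit d) (f : c.pt ⟶ d.pt)
    (hf : ∀ j, c.ι.app j ≫ f = α.app j ≫ d.ι.app j) : QuasiIso f := by
  have := quasiIso_complexOfFunctorMap α hα
  have : (colim (J := J) (C := C)).Additive := ⟨fun {F G f g} => by
    refine colimit.hom_ext fun j => ?_
    simp⟩
  have : PreservesFiniteColimits (colim (J := J) (C := C)) :=
    ⟨fun K _ _ => (colimConstAdj.leftAdjoint_preservesColimits.{0, 0}).1⟩
  -- The degreewise colimit is the exact functor `colim` applied to the complex of diagrams, so `g`
  -- is a quasi-isomorphism; `f` is `g` up to uniqueness of colimits.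
  let g : (HomologicalComplex.coconeOfHasColimitEval F).pt ⟶
      (HomologicalComplex.coconeOfHasColimitEval G).pt :=
    ((colim (J := J) (C := C)).mapHomologicalComplex _).map (complexOfFunctorMap α)
  have hg : QuasiIso g := HomologicalComplex.quasiIso_map_of_preservesHomology _ _
  let e := hc.coconePointUniqueUpToIso (HomologicalComplex.isColimitCoconeOfHasColimitEval F)
  let e' := hd.coconePointUniqueUpToIso (HomologicalComplex.isColimitCoconeOfHasColimitEval G)
  refine quasiIso_of_arrow_mk_iso g f (Arrow.isoMk e.symm e'.symm ?_)
  rw [← cancel_epi e.hom]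
  refine hc.hom_ext fun j => ?_
  have h₁ : c.ι.app j ≫ e.hom = _ := hc.comp_coconePointUniqueUpToIso_hom _ j
  have h₂ : _ ≫ e'.inv = d.ι.app j := hd.comp_coconePointUniqueUpToIso_inv _ j
  have h₃ : (HomologicalComplex.coconeOfHasColimitEval F).ι.app j ≫ g =
      α.app j ≫ (HomologicalComplex.coconeOfHasColimitEval G).ι.app j := by
    ext n
    exact ι_colimMap _ _
  dsimp only [Iso.symm_hom]
  rw [Iso.hom_inv_id_assoc]
  change c.ι.app j ≫ f = c.ι.app j ≫ e.hom ≫ g ≫ e'.inv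
  rw [reassoc_of% h₁, reassoc_of% h₃, h₂, hf]

end CochainComplex

open DerivedCategory

variable {J : Type w} [HasColimitsOfShape (Discrete J) C]

/-- Evaluation in each degree preserves the coproduct, so the homotopies on the summands glue degree
by degree. -/
lemma homotopy_zero_of_isColimit {X : J → CochainComplex C ℤ} {c : Cofan X} (hc : IsColimit c)
    {Y : CochainComplex C ℤ} (f : c.pt ⟶ Y) (h : ∀ j, Homotopy (c.inj j ≫ f) 0) :
    Nonempty (Homotopy f 0) := by
  let E := HomologicalComplex.eval C (ComplexShape.up ℤ)
  have hE : ∀ p, IsColimit ((E p).mapCocone c) := fun p => isColimitOfPreserves (E p) hc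
  let t : ∀ p q, Cocone (Discrete.functor X ⋙ E p) := fun p q =>
    { pt := Y.X q, ι := Discrete.natTrans fun j => (h j.as).hom p q }
  let H : ∀ p q, c.pt.X p ⟶ Y.X q := fun p q => (hE p).desc (t p q)
  have hH : ∀ p q j, (c.inj j).f p ≫ H p q = (h j).hom p q := fun p q j =>
    (hE p).fac (t p q) ⟨j⟩
  refine ⟨⟨H, fun p q hpq => (hE p).hom_ext fun ⟨j⟩ => ?_, fun p => (hE p).hom_ext fun ⟨j⟩ => ?_⟩⟩
  · change (c.inj j).f p ≫ H p q = (c.inj j).f p ≫ 0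
    rw [hH, (h j).zero _ _ hpq, comp_zero]
  · change (c.inj j).f p ≫ f.f p = (c.inj j).f p ≫ (dNext p H + prevD p H + 0)
    have := (h j).comm p
    have hj : (h j).hom = fun p q => (c.inj j).f p ≫ H p q := by ext p q; rw [hH]
    rw [hj, dNext_comp_left, prevD_comp_left] at this
    simpa using this

variable [HasDerivedCategory.{w'} C]

/-- Calculus of fractions: the derived category localizes the homotopy category at
quasi-isomorphisms. -/
lemma DerivedCategory.exists_precomp_homotopy_zero {X Y : CochainComplex C ℤ} (f : X ⟶ Y)
    (hf : Q.map f = 0) : ∃ (X' : CochainComplex C ℤ) (s : X' ⟶ X), QuasiIso s ∧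
      Nonempty (Homotopy (s ≫ f) 0) := by
  have h : Qh.map ((HomotopyCategory.quotient C _).map f) =
      Qh.map ((HomotopyCategory.quotient C _).map 0) := by
    rw [← cancel_mono ((quotientCompQhIso C).hom.app Y), quotientCompQhIso_hom_naturality,
      quotientCompQhIso_hom_naturality, hf, Functor.map_zero]
  obtain ⟨X', s, hs, hsf⟩ := (MorphismProperty.map_eq_iff_precomp Qh
    (HomotopyCategory.quasiIso C (ComplexShape.up ℤ)) _ _).1 h
  obtain ⟨X', rfl⟩ := HomotopyCategory.quotient_obj_surjective X'
  obtain ⟨s, rfl⟩ := (HomotopyCategory.quotient _ _).map_surjective s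
  rw [HomotopyCategory.quotient_map_mem_quasiIso_iff] at hs
  rw [← Functor.map_comp, Functor.map_zero, comp_zero,
    HomotopyCategory.quotient_map_eq_zero_iff] at hsf
  exact ⟨X', s, hs, hsf⟩

variable [HasExactColimitsOfShape (Discrete J) C]

/-- If coproducts are exact, the localization functor to the derived category preserves them. -/
lemma DerivedCategory.isCoproductFamily_of_isColimit {X : J → CochainComplex C ℤ} {c : Cofan X}
    (hc : IsColimit c) : IsCoproductFamily fun j => Q.map (c.inj j) := by
  -- Exactness enters here: denominators chosen separately on the summands assemble into a single
  -- quasi-isomorphism `S`. Both uniqueness and existence below rest on this.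
  have key : ∀ (X' : J → CochainComplex C ℤ) (s : ∀ j, X' j ⟶ X j) (_ : ∀ j, QuasiIso (s j)),
      ∃ S : (∐ X') ⟶ c.pt, (∀ j, Sigma.ι X' j ≫ S = s j ≫ c.inj j) ∧ QuasiIso S := by
    intro X' s hs
    refine ⟨Sigma.desc fun j => s j ≫ c.inj j, fun j => by simp, ?_⟩
    refine CochainComplex.quasiIso_of_isColimit 
      (Discrete.natTrans fun j => s j.as : Discrete.functor X' ⟶ Discrete.functor X) (fun j => hs j.as) (coproductIsCoproduct X') hc _ fun ⟨j⟩ => ?_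
    exact Sigma.ι_desc _ _
  refine .mk' (fun T f g hfg => ?_) fun T g => ?_
  · let e := Q.objObjPreimageIso T
    rw [← cancel_mono e.inv, ← sub_eq_zero, ← Preadditive.sub_comp]
    have h₀ : ∀ j, Q.map (c.inj j) ≫ (f - g) ≫ e.inv = 0 := fun j => by
      rw [← Category.assoc, Preadditive.comp_sub, hfg, sub_self, zero_comp]
    generalize (f - g) ≫ e.inv = φ at h₀
    obtain ⟨Z, a, s, hs, rfl⟩ := left_fac φ
    have h₁ : ∀ j, Q.map (c.inj j ≫ a) = 0 := fun j => by
      rw [← cancel_mono (inv (Q.map s)), zero_comp, Q.map_comp, Category.assoc, h₀]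
    choose X' s' hs' hom using fun j => exists_precomp_homotopy_zero _ (h₁ j)
    obtain ⟨S, hS, hS'⟩ := key X' s' hs'
    obtain ⟨H⟩ := homotopy_zero_of_isColimit (coproductIsCoproduct X') (S ≫ a) fun j =>
      (Homotopy.ofEq (by
        change Sigma.ι X' j ≫ S ≫ a = _
        rw [reassoc_of% (hS j)])).trans (hom j).some
    have h₂ := Q_map_eq_of_homotopy (C := C) H
    rw [Q.map_comp, Q.map_zero] at h₂
    have h₃ : Q.map a = 0 := by rwa [← cancel_epi (Q.map S), comp_zero]
    rw [h₃, zero_comp]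
  · let e := Q.objObjPreimageIso T
    choose X' s hs b hb using fun j => right_fac (g j ≫ e.inv)
    obtain ⟨S, hS, hS'⟩ := key X' s fun j => (isIso_Q_map_iff_quasiIso (C := C) (s j)).1 (hs j)
    refine ⟨inv (Q.map S) ≫ Q.map (Sigma.desc b) ≫ e.hom, fun j => ?_⟩
    have h₁ : Q.map (c.inj j) ≫ inv (Q.map S) = inv (Q.map (s j)) ≫ Q.map (Sigma.ι X' j) := by
      rw [IsIso.comp_inv_eq, Category.assoc, ← Q.map_comp, hS, Q.map_comp, IsIso.inv_hom_id_assoc]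
    rw [reassoc_of% h₁, ← Q.map_comp_assoc, Sigma.ι_desc, ← Category.assoc, ← hb, Category.assoc,
      e.inv_hom_id, Category.comp_id]

end DerivedCoproducts

/-! ### Non-degenerate modules: exact coproducts and the counit of `Γ_e` -/

section NonDegenerateModules

variable {K : Type u} [CommRing K] {A : Type v} [NonUnitalRing A] [Module K A]

lemma unitization_mul_inr (r : Unitization K A) (a : A) :
    r * Unitization.inr a = Unitization.inr (r.fst • a + r.snd * a) := by
  ext <;> simp

variable [IsScalarTower K A A] [SMulCommClass K A A]

section

variable [IsIdempotentedRing A]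

/-- The largest non-degenerate submodule of a module. -/
def nonDegenerateSubmodule (M : LeftMod K A) : Submodule (Unitization K A) M where
  carrier := {m | ∃ e : A, IsIdempotentElem e ∧ (Unitization.inr e : Unitization K A) • m = m}
  zero_mem' := ⟨0, by simp [IsIdempotentElem], smul_zero _⟩
  add_mem' := by
    rintro x y ⟨e₁, he₁, hx⟩ ⟨e₂, he₂, hy⟩
    obtain ⟨e, he, h₁, -, h₂, -⟩ := IsIdempotentedRing.exists_idem_pair e₁ e₂ he₁ he₂
    refine ⟨e, he, ?_⟩
    rw [smul_add, ← hx, ← hy, smul_smul, smul_smul, ← Unitization.inr_mul, ← Unitization.inr_mul,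
      h₁, h₂]
  smul_mem' := by
    rintro r x ⟨e₁, -, hx⟩
    obtain ⟨e, he, -, h⟩ := IsIdempotentedRing.exists_idem (r.fst • e₁ + r.snd * e₁)
    refine ⟨e, he, ?_⟩
    rw [← hx, smul_smul r, unitization_mul_inr, smul_smul, ← Unitization.inr_mul, h]

/-- The quotient by the largest non-degenerate submodule kills every leg of the cocone, hence
vanishes. -/
instance (J : Type*) [Category* J] : (IsNonDegenerate K A).IsClosedUnderColimitsOfShape J where
  colimitsOfShape_le := by
    rintro M ⟨p⟩ m
    have h : nonDegenerateSubmodule M = ⊤ := by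
      have : ModuleCat.ofHom (nonDegenerateSubmodule M).mkQ = 0 := by
        refine p.isColimit.hom_ext fun j => ?_
        ext x
        obtain ⟨e, he, hx⟩ := p.prop_diag_obj j x
        refine (Submodule.Quotient.mk_eq_zero _).2 ⟨e, he, ?_⟩
        change _ • (p.ι.app j).hom x = (p.ι.app j).hom x
        rw [← map_smul, hx]
      rw [← Submodule.ker_mkQ (nonDegenerateSubmodule M)]
      exact LinearMap.ker_eq_top.2 (congrArg ModuleCat.Hom.hom this)
    change m ∈ nonDegenerateSubmodule M
    exact h ▸ Submodule.mem_top

instance : PreservesFiniteLimits (IsNonDegenerate K A).ι := by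
  have : (IsNonDegenerate K A).ι.Additive := ⟨rfl⟩
  have : (IsNonDegenerate K A).ι.PreservesHomology :=
    ⟨fun {_ _} f => (IsNonDegenerate K A).preservesKernels_ι f,
     fun {_ _} f => (IsNonDegenerate K A).preservesCokernels_ι f⟩
  exact Functor.preservesFiniteLimits_of_preservesHomology _

instance (J : Type (max u v)) : HasExactColimitsOfShape (Discrete J) (NonDegMod K A) :=
  .domain_of_functor _ (IsNonDegenerate K A).ι

end

/-- The inclusion `AeM ⊆ M`. -/
def GamCounit (e : A) : Gam (K := K) e ⟶ 𝟭 _ where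
  app M := ObjectProperty.homMk (ModuleCat.ofHom (generatedSubmodule e M.obj).subtype)

lemma Gam_map_GamCounit (e : A) (M : NonDegMod K A) :
    (Gam e).map ((GamCounit e).app M) = (GamCounit e).app ((Gam e).obj M) :=
  rfl

lemma isIso_GamCounit_app_Gam {e : A} (he : IsIdempotentElem e) (M : NonDegMod K A) :
    IsIso ((GamCounit e).app ((Gam e).obj M)) :=
  ((GamGamIso (K := K) he).app M).isIso_hom

lemma generatedSubmodule_zero (M : LeftMod K A) : generatedSubmodule (0 : A) M = ⊥ := by
  refine (Submodule.span_eq_bot).2 ?_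
  rintro _ ⟨a, m, rfl⟩
  simp

lemma isZero_Gam_zero_obj [IsIdempotentedRing A] (M : NonDegMod K A) :
    IsZero ((Gam (0 : A)).obj M) := by
  rw [IsZero.iff_id_eq_zero]
  ext ⟨x, hx⟩
  rw [generatedSubmodule_zero] at hx
  exact Subtype.ext hx

end NonDegenerateModules

/-! ### The decomposition of a module into the `A e_i M` -/

namespace IsFullFamily

variable {K : Type u} [CommRing K] {A : Type v} [NonUnitalRing A] [Module K A]
  [IsScalarTower K A A] [SMulCommClass K A A] {I : Type w} {e : I → A} (h : IsFullFamily K e)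
include h

/-- Otherwise `e_i = e_i e_i e_j = 0`. Thus the nonzero members can be indexed by elements of `A`,
whatever the universe of `I`. -/
lemma eq_of_ne_zero {i j : I} (hi : e i ≠ 0) (hij : e i = e j) : i = j := by
  by_contra hne
  have := (h.stronglyOrthogonal i j hne (e i)).1
  rw [← hij, (h.isLeftSpecial i).idem.eq, (h.isLeftSpecial i).idem.eq] at this
  exact hi this

lemma comp {J : Type*} {σ : J → I} (hσ : Function.Injective σ)
    (hI : ∀ i, e i ≠ 0 → i ∈ Set.range σ) : IsFullFamily K (e ∘ σ) where
  isLeftSpecial j := h.isLeftSpecial (σ j)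
  stronglyOrthogonal i j hij := h.stronglyOrthogonal _ _ (hσ.ne hij)
  sum_eq_top := by
    rw [eq_top_iff, ← h.sum_eq_top, Submodule.span_le]
    rintro _ ⟨i, a, b, rfl⟩
    by_cases hi : e i = 0
    · simp [hi]
    · obtain ⟨j, rfl⟩ := hI i hi
      exact Submodule.subset_span ⟨j, a, b, rfl⟩

lemma iSup_generatedSubmodule (M : NonDegMod K A) :
    ⨆ i, generatedSubmodule (e i) M.obj = ⊤ := by
  refine eq_top_iff.2 fun m _ => ?_
  obtain ⟨f, -, hf⟩ := M.property m
  rw [← hf]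
  clear hf
  have hf' : f ∈ Submodule.span K {x : A | ∃ (i : I) (a b : A), x = a * e i * b} :=
    h.sum_eq_top ▸ Submodule.mem_top
  induction hf' using Submodule.span_induction with
  | mem x hx =>
    obtain ⟨i, a, b, rfl⟩ := hx
    refine Submodule.mem_iSup_of_mem i (Submodule.subset_span
      ⟨a, (Unitization.inr b : Unitization K A) • m, ?_⟩)
    rw [smul_smul, ← Unitization.inr_mul]
  | zero => simp
  | add x y _ _ hx hy =>
    rw [Unitization.inr_add, add_smul]
    exact add_mem hx hy
  | smul k x _ hx =>
    have : (Unitization.inr (k • x) : Unitization K A) =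
        (Unitization.inl k : Unitization K A) * Unitization.inr x := by
      ext <;> simp
    rw [this, mul_smul]
    exact Submodule.smul_mem _ _ hx

lemma smul_eq_zero_of_mem (M : LeftMod K A) (i : I) {x : M}
    (hx : x ∈ ⨆ (j) (_ : j ≠ i), generatedSubmodule (e j) M) (a : A) :
    (Unitization.inr (a * e i) : Unitization K A) • x = 0 := by
  -- Quantifying over all `r` makes the annihilator of `e_i` a submodule.
  let N : Submodule (Unitization K A) M :=
    { carrier := {m | ∀ r : Unitization K A,
        (Unitization.inr (e i) : Unitization K A) • r • m = 0}
      zero_mem' := by simp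
      add_mem' := fun hx hy r => by rw [smul_add, smul_add, hx, hy, add_zero]
      smul_mem' := fun s x hx r => by rw [smul_smul r, hx] }
  have hN : ⨆ (j) (_ : j ≠ i), generatedSubmodule (e j) M ≤ N := by
    refine iSup₂_le fun j hj => Submodule.span_le.2 ?_
    rintro _ ⟨b, m, rfl⟩ r
    rw [smul_smul r, unitization_mul_inr, smul_smul, ← Unitization.inr_mul,
      show r.fst • (b * e j) + r.snd * (b * e j) = (r.fst • b + r.snd * b) * e j by
        rw [add_mul, smul_mul_assoc, mul_assoc], ← mul_assoc,
      (h.stronglyOrthogonal i j hj.symm _).1, Unitization.inr_zero, zero_smul]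
  have := hN hx 1
  rw [one_smul] at this
  rw [Unitization.inr_mul, mul_smul, this, smul_zero]

/-- Left speciality is essential: it forces the intersection to be generated by its own
`e_i`-multiples, which are zero by orthogonality. -/
lemma iSupIndep_generatedSubmodule (M : NonDegMod K A) :
    iSupIndep fun i => generatedSubmodule (e i) M.obj := by
  intro i
  rw [disjoint_iff]
  set N := generatedSubmodule (e i) M.obj ⊓ ⨆ (j) (_ : j ≠ i), generatedSubmodule (e j) M.obj
  have hN := (h.isLeftSpecial i).generatedSubmodule_eq_top M N inf_le_left
  have hN' : generatedSubmodule (e i) (ModuleCat.of (Unitization K A) N) ≤ ⊥ := by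
    refine Submodule.span_le.2 ?_
    rintro _ ⟨a, ⟨x, hx⟩, rfl⟩
    exact Subtype.ext (h.smul_eq_zero_of_mem M.obj i hx.2 a)
  rw [hN] at hN'
  exact (Submodule.eq_bot_iff _).2 fun x hx =>
    congrArg Subtype.val (hN' (x := (⟨x, hx⟩ : N)) Submodule.mem_top)

/-- A non-degenerate module is the direct sum of its submodules `A e_i M`. -/
lemma isInternal_generatedSubmodule [DecidableEq I] (M : NonDegMod K A) :
    DirectSum.IsInternal fun i => generatedSubmodule (e i) M.obj :=
  DirectSum.isInternal_submodule_of_iSupIndep_of_iSup_eq_top (h.iSupIndep_generatedSubmodule M)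
    (h.iSup_generatedSubmodule M)

/-- A non-degenerate module is the coproduct of its submodules `A e_i M`. -/
lemma nonempty_isColimit (M : NonDegMod K A) :
    Nonempty (IsColimit (Cofan.mk M fun i => (GamCounit (e i)).app M)) := by
  classical
  have hM := h.isInternal_generatedSubmodule M
  let E := LinearEquiv.ofBijective (DirectSum.coeLinearMap _) hM
  have hE : ∀ i x, E.symm x.1 = DirectSum.lof (Unitization K A) I
      (fun i => generatedSubmodule (e i) M.obj) i x := fun i x => by
    rw [LinearEquiv.symm_apply_eq]
    exact (DirectSum.coeLinearMap_lof (fun i => generatedSubmodule (e i) M.obj) i x).symm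
  refine ⟨Cofan.IsColimit.mk _ (fun t => ObjectProperty.homMk (ModuleCat.ofHom
    ((DirectSum.toModule _ I t.pt.obj fun i => (t.inj i).hom.hom) ∘ₗ E.symm.toLinearMap)))
    (fun t i => ?_) fun t m hm => ?_⟩
  · ext x
    change DirectSum.toModule _ I t.pt.obj (fun i => (t.inj i).hom.hom) (E.symm x.1) = _
    exact (congrArg _ (hE i x)).trans (DirectSum.toModule_lof _ _ _)
  · ext x
    change m.hom.hom x = DirectSum.toModule _ I t.pt.obj (fun i => (t.inj i).hom.hom) (E.symm x)
    obtain ⟨y, rfl⟩ := E.surjective x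
    rw [E.symm_apply_apply]
    change (m.hom.hom ∘ₗ E.toLinearMap) y = _
    congr 1
    refine DirectSum.linearMap_ext _ fun i => LinearMap.ext fun z => ?_
    have := congrArg (fun f => f.hom.hom z) (hm i)
    have lof : DirectSum.toModule _ I t.pt.obj (fun i => (t.inj i).hom.hom)
        (DirectSum.lof (Unitization K A) I (fun i => generatedSubmodule (e i) M.obj) i z) =
          (t.inj i).hom.hom z := DirectSum.toModule_lof _ _ _
    refine Eq.trans ?_ (this.trans lof.symm)
    exact congrArg m.hom.hom
      (DirectSum.coeLinearMap_lof (fun i => generatedSubmodule (e i) M.obj) i z)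

end IsFullFamily

/-! ### Extending the counit to the derived category -/

section DerivedCounit

variable {C : Type u} [Category.{v} C] [Abelian C] {F : C ⥤ C} [F.Additive] (ε : F ⟶ 𝟭 C)

/-- The extension of a natural transformation `F ⟶ 𝟭 C` to cochain complexes. -/
def CategoryTheory.NatTrans.complexCounit :
    F.mapHomologicalComplex (ComplexShape.up ℤ) ⟶ 𝟭 (CochainComplex C ℤ) where
  app X := { f n := ε.app (X.X n), comm' m n _ := (ε.naturality (X.d m n)).symm }
  naturality X Y f := by ext n; exact ε.naturality (f.f n)

variable [PreservesFiniteLimits F] [PreservesFiniteColimits F] [HasDerivedCategory.{w'} C]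

open DerivedCategory

/-- The extension of a natural transformation `F ⟶ 𝟭 C`, for `F` exact, to the derived category. -/
noncomputable def CategoryTheory.NatTrans.derivedCounit :
    F.mapDerivedCategory ⟶ 𝟭 (DerivedCategory C) :=
  Localization.liftNatTrans Q (HomologicalComplex.quasiIso C (ComplexShape.up ℤ))
    (F.mapHomologicalComplex _ ⋙ Q) Q F.mapDerivedCategory (𝟭 _)
    (Functor.whiskerRight ε.complexCounit Q ≫ (Functor.leftUnitor _).hom)

lemma CategoryTheory.NatTrans.derivedCounit_app_Q_obj (X : CochainComplex C ℤ) :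
    ε.derivedCounit.app (Q.obj X) =
      F.mapDerivedCategoryFactors.hom.app X ≫ Q.map (ε.complexCounit.app X) := by
  rw [NatTrans.derivedCounit, Localization.liftNatTrans_app]
  simp [Localization.Lifting.iso]

variable {ε}

lemma CategoryTheory.NatTrans.derivedCounit_app_map_Q_obj (X : CochainComplex C ℤ) :
    ε.derivedCounit.app (F.mapDerivedCategory.obj (Q.obj X)) =
      F.mapDerivedCategory.map (F.mapDerivedCategoryFactors.hom.app X) ≫
        F.mapDerivedCategoryFactors.hom.app _ ≫
          Q.map (ε.complexCounit.app ((F.mapHomologicalComplex _).obj X)) ≫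
            F.mapDerivedCategoryFactors.inv.app X := by
  have h := ε.derivedCounit.naturality (F.mapDerivedCategoryFactors.hom.app X)
  have h' := ε.derivedCounit_app_Q_obj ((F.mapHomologicalComplex _).obj X)
  dsimp at h h'
  rw [← reassoc_of% h', reassoc_of% h]
  simp

/-- Transformations out of a localization are compared on complexes, where the identity holds
degreewise. -/
lemma CategoryTheory.NatTrans.map_derivedCounit_app
    (hε : ∀ M, F.map (ε.app M) = ε.app (F.obj M)) (M : DerivedCategory C) :
    F.mapDerivedCategory.map (ε.derivedCounit.app M) =
      ε.derivedCounit.app (F.mapDerivedCategory.obj M) := by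
  have h : Functor.whiskerRight ε.derivedCounit F.mapDerivedCategory ≫
      (Functor.leftUnitor _).hom = Functor.whiskerLeft F.mapDerivedCategory ε.derivedCounit ≫
        (Functor.rightUnitor _).hom := by
    refine Localization.natTrans_ext Q (HomologicalComplex.quasiIso C (ComplexShape.up ℤ))
      fun X => ?_
    have hX : (F.mapHomologicalComplex _).map (ε.complexCounit.app X) =
        ε.complexCounit.app ((F.mapHomologicalComplex _).obj X) := by
      ext n
      exact hε (X.X n)
    have h := F.mapDerivedCategoryFactors_hom_naturality (ε.complexCounit.app X)
    rw [hX] at h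
    change F.mapDerivedCategory.map (ε.derivedCounit.app (Q.obj X)) ≫ 𝟙 _ =
      ε.derivedCounit.app (F.mapDerivedCategory.obj (Q.obj X)) ≫ 𝟙 _
    rw [Category.comp_id, Category.comp_id, NatTrans.derivedCounit_app_map_Q_obj,
      NatTrans.derivedCounit_app_Q_obj, Functor.map_comp]
    congr 1
    rw [← Category.assoc]
    exact (Iso.eq_comp_inv (F.mapDerivedCategoryFactors.app X)).2 h
  simpa using congrArg (fun τ => τ.app M) h

lemma CategoryTheory.NatTrans.isIso_derivedCounit_app
    (hε : ∀ M, IsIso (ε.app (F.obj M))) (M : DerivedCategory C) :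
    IsIso (ε.derivedCounit.app (F.mapDerivedCategory.obj M)) := by
  rw [← NatTrans.isIso_app_iff_of_iso _ (F.mapDerivedCategory.mapIso (Q.objObjPreimageIso M)),
    NatTrans.derivedCounit_app_map_Q_obj]
  have : IsIso (ε.complexCounit.app ((F.mapHomologicalComplex _).obj (Q.objPreimage M))) := by
    have : ∀ n, IsIso ((ε.complexCounit.app
        ((F.mapHomologicalComplex _).obj (Q.objPreimage M))).f n) := fun n => hε _
    exact HomologicalComplex.Hom.isIso_of_components _
  infer_instance

end DerivedCounit

/-! ### Coproduct decompositions in the derived category -/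

section

open DerivedCategory

variable {C : Type u} [Category.{v} C] [Abelian C] [HasDerivedCategory.{w'} C]

lemma isZero_mapDerivedCategory_obj {F : C ⥤ C} [F.Additive] [PreservesFiniteLimits F]
    [PreservesFiniteColimits F] (hF : ∀ M, IsZero (F.obj M)) (M : DerivedCategory C) :
    IsZero (F.mapDerivedCategory.obj M) := by
  refine IsZero.of_iso ?_ (F.mapDerivedCategory.mapIso (Q.objObjPreimageIso M).symm ≪≫
    F.mapDerivedCategoryFactors.app _)
  refine Functor.map_isZero Q ?_
  rw [IsZero.iff_id_eq_zero]
  ext n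
  exact (hF _).eq_of_src _ _

variable {J : Type w} [HasColimitsOfShape (Discrete J) C] [HasExactColimitsOfShape (Discrete J) C]

lemma exists_isCoproductFamily (Y : J → DerivedCategory C) :
    ∃ (X : DerivedCategory C) (ι : ∀ j, Y j ⟶ X), IsCoproductFamily ι :=
  ⟨Q.obj (∐ fun j => Q.objPreimage (Y j)), _,
    (isCoproductFamily_of_isColimit (coproductIsCoproduct fun j => Q.objPreimage (Y j))).of_iso
      (fun j => Q.objObjPreimageIso (Y j)) (Iso.refl _)
      (ι' := fun j => (Q.objObjPreimageIso (Y j)).inv ≫ Q.map (Sigma.ι (fun j => Q.objPreimage (Y j)) j))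
      fun j => by simp [Cofan.inj]⟩

/-- A complex representing `M` decomposes degreewise; localizing this coproduct and transporting
along the representing isomorphism gives the claim. -/
lemma isCoproductFamily_derivedCounit {F : J → C ⥤ C} [∀ j, (F j).Additive]
    [∀ j, PreservesFiniteLimits (F j)] [∀ j, PreservesFiniteColimits (F j)]
    (ε : ∀ j, F j ⟶ 𝟭 C) (hε : ∀ M, Nonempty (IsColimit (Cofan.mk M fun j => (ε j).app M)))
    (M : DerivedCategory C) : IsCoproductFamily fun j => (ε j).derivedCounit.app M := by
  let X := Q.objPreimage M
  have hX : IsColimit (Cofan.mk X fun j => (ε j).complexCounit.app X) := by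
    refine HomologicalComplex.isColimitOfEval _ _ fun n => ?_
    exact (Cofan.isColimitMapCoconeEquiv _ _ _).symm (hε (X.X n)).some
  refine (isCoproductFamily_of_isColimit hX).of_iso
    (fun j => ((F j).mapDerivedCategoryFactors.app X).symm ≪≫
      (F j).mapDerivedCategory.mapIso (Q.objObjPreimageIso M)) (Q.objObjPreimageIso M) fun j => ?_
  have h := (ε j).derivedCounit.naturality (Q.objObjPreimageIso M).hom
  dsimp at h ⊢
  rw [Category.assoc, h, NatTrans.derivedCounit_app_Q_obj, Category.assoc, Iso.inv_hom_id_app_assoc]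

end

theorem theorem3p30 {K : Type u} [CommRing K] {A : Type v} [NonUnitalRing A] [Module K A]
    [IsScalarTower K A A] [SMulCommClass K A A] [IsIdempotentedRing A]
    [HasDerivedCategory.{w'} (NonDegMod K A)] {I : Type w} (e : I → A)
    (h : IsFullFamily K e) :
    (derivedPi h.isLeftSpecial).IsEquivalence := by
  have hl := fun i => (h.isLeftSpecial i).exact_Gam.1
  have hr := fun i => (h.isLeftSpecial i).exact_Gam.2
  -- Exact coproducts are available for index types in `Type (max u v)`, but `I` lies in `Type w`.
  -- Indexing by the nonzero values of `e` discards only zero summands.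
  let J := ULift.{u} {a : A // a ≠ 0 ∧ a ∈ Set.range e}
  let σ : J → I := fun j => j.down.2.2.choose
  have hσ : ∀ j, e (σ j) = j.down.1 := fun j => j.down.2.2.choose_spec
  have hinj : Function.Injective σ := fun j j' hj =>
    ULift.ext _ _ (Subtype.ext (by rw [← hσ, ← hσ, hj]))
  have hrange : ∀ i, e i ≠ 0 → i ∈ Set.range σ := fun i hi =>
    ⟨⟨e i, hi, i, rfl⟩, (h.eq_of_ne_zero hi (hσ ⟨e i, hi, i, rfl⟩).symm).symm⟩
  have hzero : ∀ i, i ∉ Set.range σ → ∀ M, IsZero ((derivedGam (h.isLeftSpecial i)).obj M) :=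
    fun i hi M => isZero_mapDerivedCategory_obj (F := Gam (K := K) (e i)) (fun N => by
      rw [not_not.1 (mt (hrange i) hi)]
      exact isZero_Gam_zero_obj N) M
  have hJ := h.comp hinj hrange
  refine isEquivalence_pi_of_isCoproductFamily (fun i => derivedGam (h.isLeftSpecial i))
    (fun i => (GamCounit (K := K) (e i)).derivedCounit) (fun i => derivedPart (h.isLeftSpecial i))
    (fun _ _ => Iff.rfl) (fun i => derivedPart_derivedGam_obj (h.isLeftSpecial i))
    (fun i => NatTrans.map_derivedCounit_app (Gam_map_GamCounit (e i)))
    (fun i => NatTrans.isIso_derivedCounit_app (isIso_GamCounit_app_Gam (h.isLeftSpecial i).idem))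
    (fun M => ?_) fun Y hY => ?_
  · exact .of_comp (σ := σ) (fun i hi => hzero i hi M)
      (isCoproductFamily_derivedCounit (fun j => GamCounit (K := K) (e (σ j)))
        hJ.nonempty_isColimit M)
  · obtain ⟨X, ι, hι⟩ := exists_isCoproductFamily fun j => Y (σ j)
    classical
    let ι' : ∀ i, Y i ⟶ X := fun i =>
      if hi : i ∈ Set.range σ then eqToHom (by rw [hi.choose_spec]) ≫ ι hi.choose else 0
    refine ⟨X, ι', .of_comp (σ := σ) (fun i hi => (hzero i hi _).of_iso (hY i).some.symm) ?_⟩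
    have hι' : (fun j => ι' (σ j)) = ι := by
      funext j
      have hj : σ j ∈ Set.range σ := ⟨j, rfl⟩
      -- The chosen preimage of `σ j` equals `j` only through injectivity of `σ`, so the transport
      -- is handled for a general `j'`.
      have key : ∀ j' (hj' : σ j' = σ j), eqToHom (by rw [hj']) ≫ ι j' = ι j := by
        intro j' hj'
        obtain rfl := hinj hj'
        simp
      simp only [ι', dif_pos hj]
      exact key _ hj.choose_spec
    exact hι'.symm ▸ hι
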